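/- A configuration in $\mathbb R^d$ is a finite indexed family of points of $\mathbb R^d$. It is in \emph{general position} if, for every $k=1,\dots,d$, every $k+1$ of its points (taken with distinct indices) span a $k$-dimensional affine subspace; in particular, for $d\ge 1$, points with distinct indices are distinct. For $x\in\mathbb R^d$ let $\hat x\in\mathbb R^{d+1}$ be $x$ with an additional last coordinate equal to $1$. Two configurations $(p_i)$ and $(q_j)$ in $\mathbb R^d$ are \emph{strictly separated by a quadric} if there is a real symmetric $(d+1)\times(d+1)$ matrix $A$ with $\hat q_j^{\,t}A\hat q_j<0<\hat p_i^{\,t}A\hat p_i$ for all $i$ and $j$. A framework $(G,x)$, that is, a graph $G$ with a configuration $x$ of its vertices in $\mathbb R^d$, is \emph{universally rigid} if, for every $D$, every configuration $y$ of the vertices of $G$ in $\mathbb R^D$ giving all edges of $G$ the same lengths as $x$ is congruent to $x$, i.e. all pairwise distances agree. Let $p=(p_1,\dots,p_n)$ and $q=(q_1,\dots,q_m)$ be configurations in $\mathbb R^d$. Suppose that there are subconfigurations $p'=(p_i)_{i\in I}$ of $p$ and $q'=(q_j)_{j\in J}$ of $q$, where $I\subseteq\{1,\dots,n\}$ and $J\subseteq\{1,\dots,m\}$,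 such that the joint configuration $(p',q')$, indexed by the disjoint union of $I$ and $J$, is in general position in $\mathbb R^d$ and such that $p'$ and $q'$ are not strictly separated by a quadric. Then the framework $(K(n,m),p,q)$, in which the complete bipartite graph $K(n,m)$ has its two vertex classes placed at $p$ and at $q$, is universally rigid. Moreover, the affine span of $p$ and the affine span of $q$ are both equal to $\mathbb R^d$. -/

import Mathlib

open scoped Matrix

namespace BipartiteRigidity

/-- A configuration `x` of (labelled) points of `ℝ^d` is in general position if, for
`k = 1, …, d`, every `k + 1` of its points span a `k`-dimensional affine subspace. -/
def InGeneralPosition {d : ℕ} {ι : Type*} (x : ι → EuclideanSpace ℝ (Fin d)) : Prop :=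
  ∀ k : ℕ, 1 ≤ k → k ≤ d → ∀ s : Finset ι, s.card = k + 1 →
    Module.finrank ℝ (affineSpan ℝ (x '' (s : Set ι))).direction = k

/-- The vector `x̂ ∈ ℝ^(d+1)` obtained from `x ∈ ℝ^d` by adding a `1` as the last coordinate. -/
def hat {d : ℕ} (x : EuclideanSpace ℝ (Fin d)) : Fin (d + 1) → ℝ :=
  Fin.snoc (α := fun _ => ℝ) (fun i => x i) 1

/-- The configurations `p` and `q` are strictly separated by a quadric: some symmetric matrix `A`
satisfies `q̂ⱼᵗ A q̂ⱼ < 0 < p̂ᵢᵗ A p̂ᵢ` for all `i` and `j`. -/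
def StrictlySeparatedByQuadric {d : ℕ} {ι κ : Type*}
    (p : ι → EuclideanSpace ℝ (Fin d)) (q : κ → EuclideanSpace ℝ (Fin d)) : Prop :=
  ∃ A : Matrix (Fin (d + 1)) (Fin (d + 1)) ℝ, A.IsSymm ∧
    (∀ j, hat (q j) ⬝ᵥ A *ᵥ hat (q j) < 0) ∧ (∀ i, 0 < hat (p i) ⬝ᵥ A *ᵥ hat (p i))

/-- The framework `(G, x)` in `ℝ^d` is universally rigid: in every `ℝ^D`, any framework of `G`
with the same edge lengths is congruent to `(G, x)`. (`Congruent` says that all pairwise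
distances agree.) -/
def UniversallyRigid {V : Type*} (G : SimpleGraph V) {d : ℕ}
    (x : V → EuclideanSpace ℝ (Fin d)) : Prop :=
  ∀ (D : ℕ) (y : V → EuclideanSpace ℝ (Fin D)),
    (∀ u v, G.Adj u v → dist (y u) (y v) = dist (x u) (x v)) → Congruent y x

end BipartiteRigidity

/-! Points x are lifted to x̂. If no quadric separates p' from q', convex duality gives weights l, m
≥ 0, not all zero, with ∑ lᵢ p̂ᵢp̂ᵢᵗ = ∑ mⱼ q̂ⱼq̂ⱼᵗ = M. The supports of l and m then have the same
affine hull, and general position forces it to be the whole space, so M is positive definite.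

The stress ωᵢⱼ = lᵢ mⱼ p̂ᵢᵗM⁻¹q̂ⱼ on the edges is positive semidefinite: by `energy_eq` its energy
is the residual of two weighted least-squares fits plus an M-norm of the difference of the two fits.
The energy depends only on edge lengths and vanishes at (p, q). In any placement with the same edge
lengths both fits are therefore exact and equal: on the supports it is an affine image of (p, q)
(`exists_affineMap_of_dist_eq`). That map preserves distances between two affinely spanning sets, so
it is an isometry, and every other vertex is fixed by its distances to the opposite support. -/

namespace BipartiteRigidity

open scoped RealInnerProductSpace

/-! ### Energy of the stress -/

/-- The weighted sum of squared residuals at a solution of the normal equations. -/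
theorem sum_residual_sq {ι n : Type*} [Fintype ι] [Fintype n] (u : ι → n → ℝ) (l : ι → ℝ)
    (M : Matrix n n ℝ) (hu : ∀ x : n → ℝ, M *ᵥ x = ∑ i, (l i * (u i ⬝ᵥ x)) • u i)
    (a : ι → ℝ) (α S : n → ℝ) (hS : S = ∑ i, (l i * a i) • u i) (hM : M *ᵥ α = S) :
    ∑ i, l i * (a i - u i ⬝ᵥ α) ^ 2 = ∑ i, l i * a i ^ 2 - S ⬝ᵥ α := by
  -- The cross term and the square term of the expansion both equal `S ⬝ᵥ α`, the latter because `M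
  -- *ᵥ α = S`.
  have h1 : S ⬝ᵥ α = ∑ i, l i * a i * (u i ⬝ᵥ α) := by rw [hS]; simp [sum_dotProduct]
  have h2 : S ⬝ᵥ α = ∑ i, l i * (u i ⬝ᵥ α) * (u i ⬝ᵥ α) := by
    rw [← hM, hu]; simp [sum_dotProduct]
  calc ∑ i, l i * (a i - u i ⬝ᵥ α) ^ 2
      = ∑ i, l i * a i ^ 2 - 2 * ∑ i, l i * a i * (u i ⬝ᵥ α)
        + ∑ i, l i * (u i ⬝ᵥ α) * (u i ⬝ᵥ α) := by
        rw [Finset.mul_sum, ← Finset.sum_sub_distrib, ← Finset.sum_add_distrib]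
        exact Finset.sum_congr rfl fun i _ => by ring
    _ = _ := by rw [← h1, ← h2]; ring

/-- The energy of a real-valued function on a complete bipartite graph, for the stress
associated with two weighted families of vectors that have the same second moments. -/
theorem energy_eq {ι κ n : Type*} [Fintype ι] [Fintype κ] [Fintype n] [DecidableEq n]
    (u : ι → n → ℝ) (v : κ → n → ℝ) (l : ι → ℝ) (m : κ → ℝ) (e : n → ℝ) (M N : Matrix n n ℝ)
    (hu : ∀ x : n → ℝ, M *ᵥ x = ∑ i, (l i * (u i ⬝ᵥ x)) • u i)
    (hv : ∀ x : n → ℝ, M *ᵥ x = ∑ j, (m j * (v j ⬝ᵥ x)) • v j)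
    (hMN : M * N = 1) (hNM : N * M = 1)
    (hN : ∀ x y : n → ℝ, x ⬝ᵥ N *ᵥ y = y ⬝ᵥ N *ᵥ x)
    (heu : ∀ i, u i ⬝ᵥ e = 1) (hev : ∀ j, v j ⬝ᵥ e = 1) (a : ι → ℝ) (b : κ → ℝ)
    (α β : n → ℝ) (hα : α = N *ᵥ ∑ i, (l i * a i) • u i) (hβ : β = N *ᵥ ∑ j, (m j * b j) • v j) :
    ∑ i, ∑ j, l i * m j * (u i ⬝ᵥ N *ᵥ v j) * (a i - b j) ^ 2 =
      ∑ i, l i * (a i - u i ⬝ᵥ α) ^ 2 + ∑ j, m j * (b j - v j ⬝ᵥ β) ^ 2 +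
        (α - β) ⬝ᵥ M *ᵥ (α - β) := by
  set S := ∑ i, (l i * a i) • u i with hS
  set T := ∑ j, (m j * b j) • v j with hT
  have hMe_u : ∑ i, l i • u i = M *ᵥ e := by simp [hu, heu]
  have hMe_v : ∑ j, m j • v j = M *ᵥ e := by simp [hv, hev]
  -- Since ∑ mⱼ vⱼ = M e, the inverse N cancels and leaves uᵢ · e = 1. Hence the squares aᵢ² and bⱼ²
  -- enter the energy with weights lᵢ and mⱼ alone.
  have hrow : ∀ i, ∑ j, m j * (u i ⬝ᵥ N *ᵥ v j) = 1 := by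
    intro i
    calc ∑ j, m j * (u i ⬝ᵥ N *ᵥ v j) = u i ⬝ᵥ N *ᵥ (∑ j, m j • v j) := by
          simp [Matrix.mulVec_sum, Matrix.mulVec_smul, dotProduct_sum]
      _ = 1 := by rw [hMe_v, Matrix.mulVec_mulVec, hNM, Matrix.one_mulVec, heu]
  have hcol : ∀ j, ∑ i, l i * (u i ⬝ᵥ N *ᵥ v j) = 1 := by
    intro j
    calc ∑ i, l i * (u i ⬝ᵥ N *ᵥ v j) = (∑ i, l i • u i) ⬝ᵥ N *ᵥ v j := by
          simp [sum_dotProduct]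
      _ = 1 := by
        rw [hMe_u, hN, Matrix.mulVec_mulVec, hNM, Matrix.one_mulVec, hev]
  have hcross : ∑ i, ∑ j, l i * m j * (u i ⬝ᵥ N *ᵥ v j) * (a i * b j) = S ⬝ᵥ β := by
    rw [hβ, hS, hT, sum_dotProduct]
    refine Finset.sum_congr rfl fun i _ => ?_
    rw [Matrix.mulVec_sum, dotProduct_sum]
    refine Finset.sum_congr rfl fun j _ => ?_
    simp [Matrix.mulVec_smul]
    ring
  have hMα : M *ᵥ α = S := by rw [hα, Matrix.mulVec_mulVec, hMN, Matrix.one_mulVec]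
  have hMβ : M *ᵥ β = T := by rw [hβ, Matrix.mulVec_mulVec, hMN, Matrix.one_mulVec]
  have hα' : ∑ i, l i * (a i - u i ⬝ᵥ α) ^ 2 = ∑ i, l i * a i ^ 2 - S ⬝ᵥ α :=
    sum_residual_sq u l M hu a α S hS hMα
  have hβ' : ∑ j, m j * (b j - v j ⬝ᵥ β) ^ 2 = ∑ j, m j * b j ^ 2 - T ⬝ᵥ β :=
    sum_residual_sq v m M hv b β T hT hMβ
  have hsymm : T ⬝ᵥ α = S ⬝ᵥ β := by rw [hα, hβ, hN]
  have hquad : (α - β) ⬝ᵥ M *ᵥ (α - β) = S ⬝ᵥ α + T ⬝ᵥ β - 2 * (S ⬝ᵥ β) := by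
    rw [Matrix.mulVec_sub, hMα, hMβ, dotProduct_comm]
    simp only [sub_dotProduct, dotProduct_sub]
    rw [hsymm]; ring
  rw [hα', hβ', hquad]
  calc ∑ i, ∑ j, l i * m j * (u i ⬝ᵥ N *ᵥ v j) * (a i - b j) ^ 2
      = ∑ i, l i * a i ^ 2 * ∑ j, m j * (u i ⬝ᵥ N *ᵥ v j)
        + ∑ j, m j * b j ^ 2 * ∑ i, l i * (u i ⬝ᵥ N *ᵥ v j)
        - 2 * ∑ i, ∑ j, l i * m j * (u i ⬝ᵥ N *ᵥ v j) * (a i * b j) := by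
        simp only [Finset.mul_sum]
        rw [Finset.sum_comm (s := (Finset.univ : Finset κ)), ← Finset.sum_add_distrib,
          ← Finset.sum_sub_distrib]
        refine Finset.sum_congr rfl fun i _ => ?_
        rw [← Finset.sum_add_distrib, ← Finset.sum_sub_distrib]
        exact Finset.sum_congr rfl fun j _ => by ring
    _ = _ := by rw [hcross]; simp only [hrow, hcol, mul_one]; ring

/-! ### Lifts and affine functionals -/

theorem hat_dotProduct_snoc {d : ℕ} (x v : EuclideanSpace ℝ (Fin d)) (c : ℝ) :
    hat x ⬝ᵥ (Fin.snoc (α := fun _ => ℝ) (fun i => v i) c : Fin (d + 1) → ℝ) = ⟪v, x⟫ + c := by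
  simp [hat, dotProduct, Fin.sum_univ_castSucc, PiLp.inner_apply]

theorem hat_last {d : ℕ} (x : EuclideanSpace ℝ (Fin d)) : hat x (Fin.last d) = 1 := by
  simp [hat]

theorem hat_castSucc {d : ℕ} (x : EuclideanSpace ℝ (Fin d)) (i : Fin d) :
    hat x i.castSucc = x i := by
  simp [hat]

theorem hat_dotProduct {d : ℕ} (x : EuclideanSpace ℝ (Fin d)) (f : Fin (d + 1) → ℝ) :
    hat x ⬝ᵥ f = ∑ i : Fin d, x i * f i.castSucc + f (Fin.last d) := by
  simp [hat, dotProduct, Fin.sum_univ_castSucc]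

/-- A linear functional vanishing on the lifts of an affinely spanning set is zero. -/
theorem eq_zero_of_hat_dotProduct_eq_zero {d : ℕ} {s : Set (EuclideanSpace ℝ (Fin d))}
    (hs : affineSpan ℝ s = ⊤) (f : Fin (d + 1) → ℝ) (hf : ∀ x ∈ s, hat x ⬝ᵥ f = 0) : f = 0 := by
  have h : ∀ x, hat x ⬝ᵥ f = 0 := by
    intro x
    have hx : x ∈ affineSpan ℝ s := hs ▸ AffineSubspace.mem_top ℝ _ x
    refine affineSpan_induction (p := fun x => hat x ⬝ᵥ f = 0) hx hf ?_
    intro c u v w hu hv hw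
    have e : hat (c • (u -ᵥ v) +ᵥ w) ⬝ᵥ f
        = c * (hat u ⬝ᵥ f - hat v ⬝ᵥ f) + hat w ⬝ᵥ f := by
      simp only [hat_dotProduct, vadd_eq_add, vsub_eq_sub, PiLp.add_apply, PiLp.smul_apply,
        PiLp.sub_apply, smul_eq_mul, add_mul, sub_mul, mul_sub, mul_add, Finset.sum_add_distrib,
        Finset.sum_sub_distrib, Finset.mul_sum, mul_assoc]
      ring
    rw [e, hu, hv, hw]; ring
  have h0 : f (Fin.last d) = 0 := by simpa [hat_dotProduct] using h 0
  funext i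
  refine Fin.lastCases h0 (fun i => ?_) i
  simpa [hat_dotProduct, h0] using h (EuclideanSpace.single i 1)

/-! ### Weights from non-separation -/

/-- If two configurations are not strictly separated by a quadric, then they have nonnegative
weights, not all zero, for which their lifts have the same second moments. -/
theorem exists_weights_of_not_strictlySeparated {d : ℕ} {ι κ : Type*} [Fintype ι] [Fintype κ]
    (p : ι → EuclideanSpace ℝ (Fin d)) (q : κ → EuclideanSpace ℝ (Fin d))
    (h : ¬ StrictlySeparatedByQuadric p q) :
    ∃ (l : ι → ℝ) (m : κ → ℝ), (∀ i, 0 ≤ l i) ∧ (∀ j, 0 ≤ m j) ∧ ∑ i, l i + ∑ j, m j = 1 ∧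
      ∀ a b, ∑ i, l i * (hat (p i) a * hat (p i) b) = ∑ j, m j * (hat (q j) a * hat (q j) b) := by
  classical
  -- With these signs, a linear functional positive on every `z k` is a separating quadric.
  let z : ι ⊕ κ → Fin (d + 1) → Fin (d + 1) → ℝ :=
    Sum.elim (fun i a b => hat (p i) a * hat (p i) b) (fun j a b => -(hat (q j) a * hat (q j) b))
  by_cases h0 : (0 : Fin (d + 1) → Fin (d + 1) → ℝ) ∈ convexHull ℝ (Set.range z)
  · rw [convexHull_range_eq_exists_affineCombination] at h0
    obtain ⟨s, w, hw0, hw1, hw⟩ := h0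
    rw [Finset.affineCombination_eq_linear_combination _ _ _ hw1] at hw
    let w' : ι ⊕ κ → ℝ := fun k => if k ∈ s then w k else 0
    have hw'0 : ∀ k, 0 ≤ w' k := fun k => by
      by_cases hk : k ∈ s <;> simp [w', hk, hw0]
    have hw'1 : ∑ k, w' k = 1 := by simp [w', hw1]
    have hw' : ∑ k, w' k • z k = 0 := by simp [w', hw]
    refine ⟨fun i => w' (.inl i), fun j => w' (.inr j), fun i => hw'0 _, fun j => hw'0 _,
      by rw [← hw'1, Fintype.sum_sum_type], fun a b => ?_⟩
    have hab := congrFun (congrFun hw' a) b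
    simp only [Fintype.sum_sum_type, z, Sum.elim_inl, Sum.elim_inr,
      Finset.sum_apply, Pi.smul_apply, smul_eq_mul, mul_neg, Finset.sum_neg_distrib,
      Pi.zero_apply] at hab
    linarith
  · exfalso
    obtain ⟨f, u, hf0, hf⟩ := geometric_hahn_banach_point_closed (convex_convexHull ℝ _)
      ((Set.finite_range z).isClosed_convexHull ℝ) h0
    rw [map_zero] at hf0
    have hfz : ∀ k, 0 < f (z k) := fun k =>
      hf0.trans (hf _ (subset_convexHull ℝ _ ⟨k, rfl⟩))
    -- On rank-one matrices x xᵗ the functional is the quadratic form of `B`; symmetrising only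
    -- doubles it.
    let B : Matrix (Fin (d + 1)) (Fin (d + 1)) ℝ := fun a b => f (Pi.single a (Pi.single b 1))
    have hB : ∀ x : Fin (d + 1) → ℝ, f (fun a b => x a * x b) = x ⬝ᵥ B *ᵥ x := by
      intro x
      have e : (fun a b => x a * x b) =
          ∑ a, ∑ b, (x a * x b) • (Pi.single a (Pi.single b 1) : Fin (d + 1) → Fin (d + 1) → ℝ) := by
        ext a b
        simp [Finset.sum_apply, Pi.single_apply, ite_apply]
      rw [e]
      simp only [map_sum, map_smul, smul_eq_mul, dotProduct, Matrix.mulVec, B, Finset.mul_sum]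
      exact Finset.sum_congr rfl fun a _ => Finset.sum_congr rfl fun b _ => by ring
    have hA : ∀ x : Fin (d + 1) → ℝ, x ⬝ᵥ (B + Bᵀ) *ᵥ x = 2 * f (fun a b => x a * x b) := by
      intro x
      rw [hB, Matrix.add_mulVec, dotProduct_add, Matrix.mulVec_transpose,
        dotProduct_comm x (x ᵥ* B), ← Matrix.dotProduct_mulVec]
      ring
    refine h ⟨B + Bᵀ, Matrix.isSymm_add_transpose_self B, fun j => ?_, fun i => ?_⟩
    · have := hfz (.inr j)
      have e : z (.inr j) = -(fun a b => hat (q j) a * hat (q j) b) := rfl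
      rw [e, map_neg] at this
      rw [hA]; linarith
    · have : 0 < f (fun a b => hat (p i) a * hat (p i) b) := hfz (.inl i)
      rw [hA]; linarith

/-! ### Affine spans of the supports -/

/-- The sum depends on the weighted points only through their second moments, so it can be
transferred from p to q. -/
theorem sum_mul_dotProduct_sq {ι n : Type*} [Fintype ι] [Fintype n] (l : ι → ℝ) (u : ι → n → ℝ)
    (f : n → ℝ) :
    ∑ i, l i * (u i ⬝ᵥ f) ^ 2 = ∑ a, ∑ b, f a * f b * ∑ i, l i * (u i a * u i b) := by
  simp only [Finset.mul_sum]
  calc ∑ i, l i * (u i ⬝ᵥ f) ^ 2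
      = ∑ i, ∑ a, ∑ b, f a * f b * (l i * (u i a * u i b)) := by
        refine Finset.sum_congr rfl fun i _ => ?_
        rw [sq, dotProduct, Finset.sum_mul_sum, Finset.mul_sum]
        refine Finset.sum_congr rfl fun a _ => ?_
        rw [Finset.mul_sum]
        exact Finset.sum_congr rfl fun b _ => by ring
    _ = _ := by
        rw [Finset.sum_comm]
        exact Finset.sum_congr rfl fun a _ => Finset.sum_comm

/-- Two weighted configurations with the same second moments have the same affine hull: each
point of one of them lies in the affine span of the other. -/
theorem mem_affineSpan_of_moments_eq {d : ℕ} {ι κ : Type*} [Fintype ι] [Fintype κ]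
    (p : ι → EuclideanSpace ℝ (Fin d)) (q : κ → EuclideanSpace ℝ (Fin d)) (l : ι → ℝ) (m : κ → ℝ)
    (hm : ∀ j, 0 ≤ m j)
    (hlm : ∀ a b, ∑ i, l i * (hat (p i) a * hat (p i) b) = ∑ j, m j * (hat (q j) a * hat (q j) b))
    (hne : ∃ i, l i ≠ 0) (j : κ) (hj : m j ≠ 0) :
    q j ∈ affineSpan ℝ (p '' {i | l i ≠ 0}) := by
  obtain ⟨i₀, hi₀⟩ := hne
  set S := affineSpan ℝ (p '' {i | l i ≠ 0}) with hS
  have hmem : ∀ i, l i ≠ 0 → p i ∈ S := fun i hi => subset_affineSpan ℝ _ ⟨i, hi, rfl⟩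
  have : Nonempty S := ⟨⟨p i₀, hmem i₀ hi₀⟩⟩
  let z := EuclideanGeometry.orthogonalProjection S (q j)
  let v : EuclideanSpace ℝ (Fin d) := q j - z
  have hv : v ∈ S.directionᗮ :=
    EuclideanGeometry.vsub_orthogonalProjection_mem_direction_orthogonal S (q j)
  -- The lift of the affine functional x ↦ ⟪v, x - z⟫, which vanishes on `S` and takes the value
  -- ‖v‖² at `q j`.
  let f : Fin (d + 1) → ℝ := Fin.snoc (α := fun _ => ℝ) (fun i => v i) 
    (-⟪v, (z : EuclideanSpace ℝ (Fin d))⟫)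
  have hf : ∀ x, hat x ⬝ᵥ f = ⟪v, x - z⟫ := fun x => by
    rw [hat_dotProduct_snoc, inner_sub_right]; ring
  have hsum : ∑ j, m j * (hat (q j) ⬝ᵥ f) ^ 2 = 0 := by
    rw [sum_mul_dotProduct_sq m (fun j => hat (q j))]
    simp only [← hlm]
    rw [← sum_mul_dotProduct_sq l (fun i => hat (p i))]
    refine Finset.sum_eq_zero fun i _ => ?_
    by_cases hi : l i = 0
    · simp [hi]
    · have h0 : ⟪v, p i - z⟫ = 0 := Submodule.inner_left_of_mem_orthogonal
        (AffineSubspace.vsub_mem_direction (hmem i hi) z.2) hv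
      simp [hf, h0]
  have hj0 := (Finset.sum_eq_zero_iff_of_nonneg
    (fun j _ => mul_nonneg (hm j) (sq_nonneg _))).1 hsum j (Finset.mem_univ j)
  have hvv : ⟪v, v⟫ = 0 := by
    have := (mul_eq_zero.1 hj0).resolve_left hj
    rwa [hf, sq_eq_zero_iff] at this
  have hqz : q j = z := sub_eq_zero.1 (inner_self_eq_zero.1 hvv)
  rw [hqz]; exact z.2

/-- In a configuration in general position, a set of points whose affine span contains a further
point of the configuration spans the whole space. -/
theorem InGeneralPosition.affineSpan_image_eq_top {d : ℕ} {ι : Type*}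
    {x : ι → EuclideanSpace ℝ (Fin d)} (hx : InGeneralPosition x) {S : Set ι} (hS : S.Finite)
    {j : ι} (hj : j ∉ S) (hmem : x j ∈ affineSpan ℝ (x '' S)) :
    affineSpan ℝ (x '' S) = ⊤ := by
  classical
  obtain ⟨T, hTS, hT, hind⟩ := exists_affineIndependent ℝ (EuclideanSpace ℝ (Fin d)) (x '' S)
  obtain ⟨s, hsS, hinj, rfl⟩ := Set.SurjOn.exists_subset_injOn_image_eq (f := x) (s := S) (t := T) hTS
  lift s to Finset ι using hS.subset hsS
  have hne : s.Nonempty := by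
    by_contra hs
    rw [Finset.not_nonempty_iff_eq_empty] at hs
    rw [← hT, hs] at hmem
    simp [AffineSubspace.notMem_bot] at hmem
  have hcard : Fintype.card (x '' (s : Set ι)) = (s.card - 1) + 1 := by
    rw [← Nat.card_eq_fintype_card, Nat.card_coe_set_eq, hinj.ncard_image, Set.ncard_coe_finset]
    have := hne.card_pos
    omega
  have hfr := hind.finrank_vectorSpan hcard
  rw [Subtype.range_coe] at hfr
  -- In this case adding `j` gives at most d + 1 points, whose span should have dimension `s.card`;
  -- but `x j` already lies in the span of the others, of dimension `s.card - 1`.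
  by_cases hd : s.card ≤ d
  · exfalso
    have hjs : j ∉ s := fun h => hj (hsS h)
    have h1 := hx s.card hne.card_pos hd (insert j s) (Finset.card_insert_of_notMem hjs)
    rw [Finset.coe_insert, Set.image_insert_eq, affineSpan_insert_eq_affineSpan ℝ (by rwa [hT]),
      direction_affineSpan, hfr] at h1
    have := hne.card_pos
    omega
  · rw [← hT, ← AffineSubspace.direction_eq_top_iff_of_nonempty, direction_affineSpan]
    · apply Submodule.eq_top_of_finrank_eq
      refine le_antisymm (Submodule.finrank_le _) ?_
      rw [hfr, finrank_euclideanSpace_fin]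
      omega
    · exact (affineSpan_nonempty ℝ).2 (hne.to_set.image x)

/-! ### Isometry from cross distances -/

/-- A linear map preserving the distances between two affinely spanning sets is isometric. -/
theorem norm_map_eq_of_norm_map_sub_eq {V W : Type*} [NormedAddCommGroup V]
    [InnerProductSpace ℝ V] [NormedAddCommGroup W] [InnerProductSpace ℝ W] (A : V →ₗ[ℝ] W)
    {s t : Set V} (hs : affineSpan ℝ s = ⊤) (ht : affineSpan ℝ t = ⊤)
    (h : ∀ x ∈ s, ∀ y ∈ t, ‖A (x - y)‖ = ‖x - y‖) (v : V) : ‖A v‖ = ‖v‖ := by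
  have hs' : Submodule.span ℝ (s -ᵥ s) = ⊤ := by
    rw [← vectorSpan_def, ← direction_affineSpan, hs, AffineSubspace.direction_top]
  have ht' : Submodule.span ℝ (t -ᵥ t) = ⊤ := by
    rw [← vectorSpan_def, ← direction_affineSpan, ht, AffineSubspace.direction_top]
  have h1 : ∀ v ∈ s -ᵥ s, ∀ w ∈ t -ᵥ t, ⟪A v, A w⟫ = ⟪v, w⟫ := by
    rintro _ ⟨x, hx, x', hx', rfl⟩ _ ⟨y, hy, y', hy', rfl⟩
    -- In the alternating sum over the four pairs, the norms of single points, which A is not yet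
    -- known to preserve, cancel.
    have key : ∀ x ∈ s, ∀ y ∈ t, ‖A x‖ ^ 2 - 2 * ⟪A x, A y⟫ + ‖A y‖ ^ 2
        = ‖x‖ ^ 2 - 2 * ⟪x, y⟫ + ‖y‖ ^ 2 := fun x hx y hy => by
      rw [← norm_sub_sq_real, ← norm_sub_sq_real, ← map_sub, h x hx y hy]
    have e1 := key x hx y hy
    have e2 := key x hx y' hy'
    have e3 := key x' hx' y hy
    have e4 := key x' hx' y' hy'
    simp only [vsub_eq_sub, map_sub, inner_sub_left, inner_sub_right]
    linarith
  have h2 : ∀ v ∈ s -ᵥ s, ∀ w, ⟪A v, A w⟫ = ⟪v, w⟫ := fun v hv w => by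
    refine Submodule.span_induction (p := fun w _ => ⟪A v, A w⟫ = ⟪v, w⟫) (h1 v hv) ?_ ?_ ?_
      (ht' ▸ Submodule.mem_top : w ∈ Submodule.span ℝ (t -ᵥ t))
    · simp
    · intro a b _ _ ha hb; simp [inner_add_right, ha, hb]
    · intro c a _ ha; simp [inner_smul_right, ha]
  have h3 : ∀ v w, ⟪A v, A w⟫ = ⟪v, w⟫ := fun v w => by
    refine Submodule.span_induction (p := fun v _ => ⟪A v, A w⟫ = ⟪v, w⟫) (fun v hv => h2 v hv w)
      ?_ ?_ ?_ (hs' ▸ Submodule.mem_top : v ∈ Submodule.span ℝ (s -ᵥ s))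
    · simp
    · intro a b _ _ ha hb; simp [inner_add_left, ha, hb]
    · intro c a _ ha; simp [inner_smul_left, ha]
  have := h3 v v
  rw [real_inner_self_eq_norm_sq, real_inner_self_eq_norm_sq] at this
  exact (sq_eq_sq₀ (norm_nonneg _) (norm_nonneg _)).1 this

/-- A point is determined by its distances to the image of an affinely spanning set under an
affine isometry, if they are those of some point of the domain. -/
theorem eq_map_of_dist_eq {V W : Type*} [NormedAddCommGroup V]
    [InnerProductSpace ℝ V] [NormedAddCommGroup W] [InnerProductSpace ℝ W] (f : V →ᵃ[ℝ] W)
    (hf : ∀ x y, dist (f x) (f y) = dist x y) {t : Set V} (ht : affineSpan ℝ t = ⊤) (z : V) (w : W)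
    (h : ∀ y ∈ t, dist w (f y) = dist z y) : w = f z := by
  -- The expression is affine in `f y` and vanishes for y in `t`, hence for all y; taking y = z
  -- leaves ‖w - f z‖² = 0.
  have key : ∀ y, ‖w - f z‖ ^ 2 + 2 * ⟪w - f z, f z - f y⟫ = 0 := by
    intro y
    refine affineSpan_induction (p := fun y => ‖w - f z‖ ^ 2 + 2 * ⟪w - f z, f z - f y⟫ = 0)
      (ht ▸ AffineSubspace.mem_top ℝ V y : y ∈ affineSpan ℝ t) ?_ ?_
    · intro y hy
      have e : ‖(w - f z) + (f z - f y)‖ = ‖f z - f y‖ := by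
        rw [sub_add_sub_cancel, ← dist_eq_norm, ← dist_eq_norm, h y hy, hf]
      have e2 := norm_add_sq_real (w - f z) (f z - f y)
      rw [e] at e2
      linarith
    · intro c a b d ha hb hd
      have e : f (c • (a -ᵥ b) +ᵥ d) = c • (f a - f b) + f d := by
        rw [AffineMap.map_vadd, map_smul, AffineMap.linearMap_vsub]; rfl
      rw [e]
      simp only [inner_sub_right, inner_add_right, inner_smul_right] at ha hb hd ⊢
      linear_combination c * (ha - hb) + hd
  have h0 := key z
  rw [sub_self, inner_zero_right, mul_zero, add_zero, sq_eq_zero_iff, norm_eq_zero] at h0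
  exact sub_eq_zero.1 h0

/-! ### Affine rigidity on the supports -/

/-- Two placements of a weighted complete bipartite graph with the same edge lengths, the weights
of the first one having equal and nondegenerate second moments, differ by an affine map on the
support of the weights. -/
theorem exists_affineMap_of_dist_eq {d D : ℕ} {ι κ : Type*} [Fintype ι] [Fintype κ]
    (p : ι → EuclideanSpace ℝ (Fin d)) (q : κ → EuclideanSpace ℝ (Fin d)) (l : ι → ℝ) (m : κ → ℝ)
    (hl : ∀ i, 0 ≤ l i) (hm : ∀ j, 0 ≤ m j)
    (hlm : ∀ a b, ∑ i, l i * (hat (p i) a * hat (p i) b) = ∑ j, m j * (hat (q j) a * hat (q j) b))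
    (hp : affineSpan ℝ (p '' {i | l i ≠ 0}) = ⊤)
    (a : ι → EuclideanSpace ℝ (Fin D)) (b : κ → EuclideanSpace ℝ (Fin D))
    (hab : ∀ i j, dist (a i) (b j) = dist (p i) (q j)) :
    ∃ f : EuclideanSpace ℝ (Fin d) →ᵃ[ℝ] EuclideanSpace ℝ (Fin D),
      (∀ i, l i ≠ 0 → a i = f (p i)) ∧ (∀ j, m j ≠ 0 → b j = f (q j)) := by
  classical
  let M : Matrix (Fin (d + 1)) (Fin (d + 1)) ℝ :=
    Matrix.of fun r s => ∑ i, l i * (hat (p i) r * hat (p i) s)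
  have hu : ∀ x : Fin (d + 1) → ℝ, M *ᵥ x = ∑ i, (l i * (hat (p i) ⬝ᵥ x)) • hat (p i) := by
    intro x
    ext r
    simp only [M, Matrix.mulVec, dotProduct, Matrix.of_apply, Finset.sum_mul, Finset.sum_apply,
      Pi.smul_apply, smul_eq_mul, Finset.mul_sum]
    rw [Finset.sum_comm]
    exact Finset.sum_congr rfl fun i _ => Finset.sum_congr rfl fun s _ => by ring
  have hv : ∀ x : Fin (d + 1) → ℝ, M *ᵥ x = ∑ j, (m j * (hat (q j) ⬝ᵥ x)) • hat (q j) := by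
    intro x
    ext r
    simp only [M, hlm, Matrix.mulVec, dotProduct, Matrix.of_apply, Finset.sum_mul,
      Finset.sum_apply, Pi.smul_apply, smul_eq_mul, Finset.mul_sum]
    rw [Finset.sum_comm]
    exact Finset.sum_congr rfl fun i _ => Finset.sum_congr rfl fun s _ => by ring
  have hquad : ∀ x, x ⬝ᵥ M *ᵥ x = ∑ i, l i * (hat (p i) ⬝ᵥ x) ^ 2 := fun x => by
    rw [hu, dotProduct_sum]
    refine Finset.sum_congr rfl fun i _ => ?_
    rw [dotProduct_smul, smul_eq_mul, dotProduct_comm x]; ring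
  have hnn : ∀ x, 0 ≤ x ⬝ᵥ M *ᵥ x := fun x => by
    rw [hquad]; exact Finset.sum_nonneg fun i _ => mul_nonneg (hl i) (sq_nonneg _)
  have hdef : ∀ x, x ⬝ᵥ M *ᵥ x = 0 → x = 0 := by
    intro x hx
    rw [hquad, Finset.sum_eq_zero_iff_of_nonneg
      (fun i _ => mul_nonneg (hl i) (sq_nonneg _))] at hx
    refine eq_zero_of_hat_dotProduct_eq_zero hp x ?_
    rintro _ ⟨i, hi, rfl⟩
    exact sq_eq_zero_iff.1 ((mul_eq_zero.1 (hx i (Finset.mem_univ i))).resolve_left hi)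
  have hunit : IsUnit M := by
    rw [← Matrix.mulVec_injective_iff_isUnit]
    intro x y hxy
    have hxy' : M *ᵥ x = M *ᵥ y := hxy
    refine sub_eq_zero.1 (hdef _ ?_)
    rw [Matrix.mulVec_sub, hxy', sub_self, dotProduct_zero]
  have hdet := (Matrix.isUnit_iff_isUnit_det M).1 hunit
  have hMN : M * M⁻¹ = 1 := Matrix.mul_nonsing_inv M hdet
  have hNM : M⁻¹ * M = 1 := Matrix.nonsing_inv_mul M hdet
  have hMs : Mᵀ = M := by
    ext r s
    simp only [M, Matrix.transpose_apply, Matrix.of_apply]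
    exact Finset.sum_congr rfl fun i _ => by ring
  have hN : ∀ x y : Fin (d + 1) → ℝ, x ⬝ᵥ M⁻¹ *ᵥ y = y ⬝ᵥ M⁻¹ *ᵥ x := fun x y => by
    rw [Matrix.dotProduct_mulVec, ← Matrix.mulVec_transpose, Matrix.transpose_nonsing_inv, hMs,
      dotProduct_comm]
  have he : ∀ x : EuclideanSpace ℝ (Fin d), hat x ⬝ᵥ Pi.single (Fin.last d) 1 = 1 := fun x => by
    rw [dotProduct_single_one, hat_last]
  have energy := energy_eq (fun i => hat (p i)) (fun j => hat (q j)) l m (Pi.single (Fin.last d) 1)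
    M M⁻¹ hu hv hMN hNM hN (fun i => he _) (fun j => he _)
  let ω : ι → κ → ℝ := fun i j => l i * m j * (hat (p i) ⬝ᵥ M⁻¹ *ᵥ hat (q j))
  let α : Fin D → Fin (d + 1) → ℝ := fun k => M⁻¹ *ᵥ ∑ i, (l i * a i k) • hat (p i)
  let β : Fin D → Fin (d + 1) → ℝ := fun k => M⁻¹ *ᵥ ∑ j, (m j * b j k) • hat (q j)
  have hdist : ∀ {D : ℕ} (x y : EuclideanSpace ℝ (Fin D)), dist x y ^ 2 = ∑ k, (x k - y k) ^ 2 :=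
    fun x y => by simp [EuclideanSpace.dist_sq_eq, Real.dist_eq, sq_abs]
  have hswap : ∀ {D : ℕ} (a : ι → EuclideanSpace ℝ (Fin D)) (b : κ → EuclideanSpace ℝ (Fin D)),
      ∑ i, ∑ j, ω i j * dist (a i) (b j) ^ 2
        = ∑ k, ∑ i, ∑ j, ω i j * (a i k - b j k) ^ 2 := fun a b => by
    simp only [hdist, Finset.mul_sum]
    rw [Finset.sum_comm (s := (Finset.univ : Finset (Fin _)))]
    exact Finset.sum_congr rfl fun i _ => Finset.sum_comm
  -- The k-th coordinate is itself a linear functional of the lift, so both fits are exact and have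
  -- the same coefficients.
  have hpq0 : ∀ k : Fin d, ∑ i, ∑ j, ω i j * (p i k - q j k) ^ 2 = 0 := by
    intro k
    have h1 := energy (fun i => p i k) (fun j => q j k) (Pi.single k.castSucc 1)
      (Pi.single k.castSucc 1)
      (by
        have := hu (Pi.single k.castSucc 1)
        simp only [dotProduct_single_one, hat_castSucc] at this
        rw [← this, Matrix.mulVec_mulVec, hNM, Matrix.one_mulVec])
      (by
        have := hv (Pi.single k.castSucc 1)
        simp only [dotProduct_single_one, hat_castSucc] at this
        rw [← this, Matrix.mulVec_mulVec, hNM, Matrix.one_mulVec])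
    simpa [hat_castSucc] using h1
  -- Summed over coordinates, the energy is a combination of squared edge lengths, hence the same
  -- for (a, b) as for (p, q).
  have hsum : ∑ k, (∑ i, l i * (a i k - hat (p i) ⬝ᵥ α k) ^ 2
      + ∑ j, m j * (b j k - hat (q j) ⬝ᵥ β k) ^ 2 + (α k - β k) ⬝ᵥ M *ᵥ (α k - β k)) = 0 := by
    calc _ = ∑ k, ∑ i, ∑ j, ω i j * (a i k - b j k) ^ 2 :=
          Finset.sum_congr rfl fun k _ =>
            (energy (fun i => a i k) (fun j => b j k) (α k) (β k) rfl rfl).symm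
      _ = ∑ k, ∑ i, ∑ j, ω i j * (p i k - q j k) ^ 2 := by
          rw [← hswap, ← hswap]; simp only [hab]
      _ = 0 := Finset.sum_eq_zero fun k _ => hpq0 k
  have hA : ∀ k, 0 ≤ ∑ i, l i * (a i k - hat (p i) ⬝ᵥ α k) ^ 2 := fun k =>
    Finset.sum_nonneg fun i _ => mul_nonneg (hl i) (sq_nonneg _)
  have hB : ∀ k, 0 ≤ ∑ j, m j * (b j k - hat (q j) ⬝ᵥ β k) ^ 2 := fun k =>
    Finset.sum_nonneg fun j _ => mul_nonneg (hm j) (sq_nonneg _)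
  have hC := fun k => hnn (α k - β k)
  rw [Finset.sum_eq_zero_iff_of_nonneg
    (fun k _ => add_nonneg (add_nonneg (hA k) (hB k)) (hC k))] at hsum
  have hαβ : ∀ k, α k = β k := fun k => sub_eq_zero.1 (hdef _ (by
    linarith [hA k, hB k, hC k, hsum k (Finset.mem_univ k)]))
  have hA0 : ∀ k i, l i ≠ 0 → a i k = hat (p i) ⬝ᵥ α k := fun k i hi => by
    have h0 : ∑ i, l i * (a i k - hat (p i) ⬝ᵥ α k) ^ 2 = 0 := by
      linarith [hA k, hB k, hC k, hsum k (Finset.mem_univ k)]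
    have h1 := (Finset.sum_eq_zero_iff_of_nonneg
      (fun i _ => mul_nonneg (hl i) (sq_nonneg _))).1 h0 i (Finset.mem_univ i)
    exact sub_eq_zero.1 (sq_eq_zero_iff.1 ((mul_eq_zero.1 h1).resolve_left hi))
  have hB0 : ∀ k j, m j ≠ 0 → b j k = hat (q j) ⬝ᵥ α k := fun k j hj => by
    have h0 : ∑ j, m j * (b j k - hat (q j) ⬝ᵥ β k) ^ 2 = 0 := by
      linarith [hA k, hB k, hC k, hsum k (Finset.mem_univ k)]
    have h1 := (Finset.sum_eq_zero_iff_of_nonneg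
      (fun j _ => mul_nonneg (hm j) (sq_nonneg _))).1 h0 j (Finset.mem_univ j)
    rw [hαβ]
    exact sub_eq_zero.1 (sq_eq_zero_iff.1 ((mul_eq_zero.1 h1).resolve_left hj))
  -- The first d entries of each `α k` form a row of the linear part; the last is the translation.
  let A : Matrix (Fin D) (Fin d) ℝ := Matrix.of fun k i => α k i.castSucc
  let f : EuclideanSpace ℝ (Fin d) →ᵃ[ℝ] EuclideanSpace ℝ (Fin D) :=
    (Matrix.toEuclideanLin A).toAffineMap +
      AffineMap.const ℝ _ (WithLp.toLp 2 fun k => α k (Fin.last d))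
  have hf : ∀ x k, f x k = hat x ⬝ᵥ α k := fun x k => by
    rw [hat_dotProduct]
    simp [f, A, Matrix.toEuclideanLin, Matrix.mulVec, dotProduct, mul_comm]
  exact ⟨f, fun i hi => by ext k; rw [hf, hA0 k i hi], fun j hj => by ext k; rw [hf, hB0 k j hj]⟩

end BipartiteRigidity

/-! ### Universal rigidity -/

theorem mainTheorem3 (d n m : ℕ)
    (p : Fin n → EuclideanSpace ℝ (Fin d)) (q : Fin m → EuclideanSpace ℝ (Fin d))
    (h : ∃ (I : Set (Fin n)) (J : Set (Fin m)),
      BipartiteRigidity.InGeneralPosition (Sum.elim (fun i : I => p i) (fun j : J => q j)) ∧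
      ¬ BipartiteRigidity.StrictlySeparatedByQuadric (fun i : I => p i) (fun j : J => q j)) :
    BipartiteRigidity.UniversallyRigid
        (completeBipartiteGraph (Fin n) (Fin m)) (Sum.elim p q) ∧
      affineSpan ℝ (Set.range p) = ⊤ ∧
      affineSpan ℝ (Set.range q) = ⊤ := by
  classical
  obtain ⟨I, J, hgp, hns⟩ := h
  obtain ⟨l, w, hl, hw, hlw, hmom⟩ :=
    BipartiteRigidity.exists_weights_of_not_strictlySeparated _ _ hns
  -- The last diagonal entries of the moment matrices are the total weights. They are equal and add
  -- up to 1, so neither support is empty.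
  have hsum : ∑ i, l i = ∑ j, w j := by
    simpa [BipartiteRigidity.hat_last] using hmom (Fin.last d) (Fin.last d)
  obtain ⟨i₀, -, hi₀⟩ := Finset.exists_ne_zero_of_sum_ne_zero
    (show ∑ i, l i ≠ 0 from fun h0 => by linarith)
  obtain ⟨j₀, -, hj₀⟩ := Finset.exists_ne_zero_of_sum_ne_zero
    (show ∑ j, w j ≠ 0 from fun h0 => by linarith)
  set s := (fun i : I => p i) '' {i | l i ≠ 0} with hs_def
  set t := (fun j : J => q j) '' {j | w j ≠ 0} with ht_def
  -- A point of the opposite support lies in this span and carries an index outside it, so general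
  -- position applies.
  have hs : affineSpan ℝ s = ⊤ := by
    have h1 := BipartiteRigidity.mem_affineSpan_of_moments_eq _ _ l w hw hmom ⟨i₀, hi₀⟩ j₀ hj₀
    have h2 := hgp.affineSpan_image_eq_top (S := Sum.inl '' {i | l i ≠ 0}) (j := Sum.inr j₀)
      (Set.toFinite _) (by simp) (by simpa [Set.image_image] using h1)
    simpa [Set.image_image] using h2
  have ht : affineSpan ℝ t = ⊤ := by
    have h1 := BipartiteRigidity.mem_affineSpan_of_moments_eq _ _ w l hl
      (fun a b => (hmom a b).symm) ⟨j₀, hj₀⟩ i₀ hi₀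
    have h2 := hgp.affineSpan_image_eq_top (S := Sum.inr '' {j | w j ≠ 0}) (j := Sum.inl i₀)
      (Set.toFinite _) (by simp) (by simpa [Set.image_image] using h1)
    simpa [Set.image_image] using h2
  refine ⟨fun D y hy => ?_, ?_, ?_⟩
  · have hyd : ∀ i j, dist (y (.inl i)) (y (.inr j)) = dist (p i) (q j) := fun i j => by
      simpa using hy (.inl i) (.inr j) (by simp)
    obtain ⟨f, hfp, hfq⟩ := BipartiteRigidity.exists_affineMap_of_dist_eq _ _ l w hl hw hmom hs
      (fun i : I => y (.inl i)) (fun j : J => y (.inr j)) (fun i j => hyd i j)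
    have hnorm : ∀ v, ‖f.linear v‖ = ‖v‖ := by
      refine BipartiteRigidity.norm_map_eq_of_norm_map_sub_eq f.linear hs ht ?_
      rintro _ ⟨i, hi, rfl⟩ _ ⟨j, hj, rfl⟩
      have := hyd i j
      rw [hfp i hi, hfq j hj, dist_eq_norm, dist_eq_norm, ← vsub_eq_sub (f _),
        ← AffineMap.linearMap_vsub] at this
      exact this
    have hf : ∀ x z, dist (f x) (f z) = dist x z := fun x z => by
      rw [dist_eq_norm, dist_eq_norm, ← vsub_eq_sub (f _), ← AffineMap.linearMap_vsub, hnorm,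
        vsub_eq_sub]
    -- This includes vertices outside `I` and `J`: each is joined to the whole opposite support,
    -- which spans affinely.
    have hyf : ∀ u, y u = f (Sum.elim p q u) := by
      rintro (i | j)
      · refine BipartiteRigidity.eq_map_of_dist_eq f hf ht _ _ ?_
        rintro _ ⟨j, hj, rfl⟩
        rw [← hfq j hj]; exact hyd i j
      · refine BipartiteRigidity.eq_map_of_dist_eq f hf hs _ _ ?_
        rintro _ ⟨i, hi, rfl⟩
        rw [← hfp i hi, dist_comm, hyd i j, dist_comm]; rfl
    intro u v
    rw [hyf, hyf, edist_dist, edist_dist, hf]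
  · refine top_le_iff.1 (hs ▸ affineSpan_mono ℝ ?_)
    rintro _ ⟨i, -, rfl⟩
    exact ⟨i, rfl⟩
  · refine top_le_iff.1 (ht ▸ affineSpan_mono ℝ ?_)
    rintro _ ⟨j, -, rfl⟩
    exact ⟨j, rfl⟩
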